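/- Let $s>0$ and let $S^2=\{(S_1,S_2,S_3)\in\mathbb R^3 : S_1^2+S_2^2+S_3^2=s^2\}$. Let $\mathcal P=\mathbb R[S_1,S_2,S_3]/(S_1^2+S_2^2+S_3^2-s^2)$ be the algebra of real polynomials in $S_1,S_2,S_3$ restricted to $S^2$, with the Poisson bracket $$\{f,g\}=\sum_{i,j,k=1}^3\epsilon_{ijk}\,S_i\,\frac{\partial f}{\partial S_j}\,\frac{\partial g}{\partial S_k},$$ which is well defined on $\mathcal P$. A Poisson subalgebra of $\mathcal P$ is a real linear subspace of $\mathcal P$ that is closed under $\{\cdot,\cdot\}$ (closure under multiplication is not required). Let $\mathcal P^1\subset\mathcal P$ be the subspace of elements that have a polynomial representative of degree at most $1$, let $\mathcal O\subset\mathcal P$ be the subspace of elements that have a polynomial representative all of whose terms are of odd degree, and let $\widetilde{\mathcal O}=\mathcal O\oplus\mathbb R$, where $\mathbb R$ denotes the constants. Lemma. Every Poisson subalgebra of $\mathcal P$ that strictly contains $\mathcal P^1$ also contains $\widetilde{\mathcal O}$. -/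

import Mathlib

namespace SpinSphere

open MvPolynomial

/-- The polynomial bracket `{f, g} = ∑ ε_{ijk} S_i (∂f/∂S_j) (∂g/∂S_k)` on `ℝ[S₁, S₂, S₃]`,
written out over the six nonzero values of `ε`; the indices `0, 1, 2` stand for `1, 2, 3`. -/
noncomputable def polyBracket (f g : MvPolynomial (Fin 3) ℝ) : MvPolynomial (Fin 3) ℝ :=
  X 0 * (pderiv 1 f * pderiv 2 g - pderiv 2 f * pderiv 1 g) +
  X 1 * (pderiv 2 f * pderiv 0 g - pderiv 0 f * pderiv 2 g) +
  X 2 * (pderiv 0 f * pderiv 1 g - pderiv 1 f * pderiv 0 g)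

/-- The polynomial `S₁² + S₂² + S₃² - s²`, whose zero set is the sphere of radius `s`. -/
noncomputable def spherePoly (s : ℝ) : MvPolynomial (Fin 3) ℝ :=
  X 0 ^ 2 + X 1 ^ 2 + X 2 ^ 2 - C (s ^ 2)

/-- The ideal of relations generated by `S₁² + S₂² + S₃² = s²`. -/
noncomputable def sphereIdeal (s : ℝ) : Ideal (MvPolynomial (Fin 3) ℝ) :=
  Ideal.span {spherePoly s}

/-- The algebra `𝒫` of polynomials in `S₁, S₂, S₃` modulo `S₁² + S₂² + S₃² = s²`. -/
abbrev SpherePolynomial (s : ℝ) : Type :=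
  MvPolynomial (Fin 3) ℝ ⧸ sphereIdeal s

/-- The quotient map `ℝ[S₁, S₂, S₃] → 𝒫`, as a homomorphism of real algebras. -/
noncomputable abbrev toSphere (s : ℝ) : MvPolynomial (Fin 3) ℝ →ₐ[ℝ] SpherePolynomial s :=
  Ideal.Quotient.mkₐ ℝ (sphereIdeal s)

theorem polyBracket_mem (s : ℝ) {f f' g g' : MvPolynomial (Fin 3) ℝ}
    (hf : f - f' ∈ sphereIdeal s) (hg : g - g' ∈ sphereIdeal s) :
    polyBracket f g - polyBracket f' g' ∈ sphereIdeal s := by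
  obtain ⟨a, ha⟩ := Ideal.mem_span_singleton'.1 hf
  obtain ⟨b, hb⟩ := Ideal.mem_span_singleton'.1 hg
  obtain rfl : f = f' + a * spherePoly s := by rw [ha]; ring
  obtain rfl : g = g' + b * spherePoly s := by rw [hb]; ring
  refine Ideal.mem_span_singleton'.2
    ⟨polyBracket f' b + polyBracket a g' + spherePoly s * polyBracket a b, ?_⟩
  simp only [polyBracket, spherePoly, map_add, map_sub, Derivation.leibniz, smul_eq_mul,
    Derivation.leibniz_pow, pderiv_X, pderiv_C, Pi.single_apply]
  simp
  ring

/-- The Poisson bracket of `𝒫`: the bracket of the classes of `f` and `g` is the class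
of `∑ ε_{ijk} S_i (∂f/∂S_j) (∂g/∂S_k)`. -/
noncomputable def poissonBracket (s : ℝ) :
    SpherePolynomial s → SpherePolynomial s → SpherePolynomial s :=
  fun p q => Quotient.liftOn₂' p q (fun f g => toSphere s (polyBracket f g)) (by
    intro f g f' g' hf hg
    exact (Ideal.Quotient.mk_eq_mk_iff_sub_mem _ _).2
      (polyBracket_mem s ((Submodule.quotientRel_def _).1 hf)
        ((Submodule.quotientRel_def _).1 hg)))

theorem poissonBracket_toSphere (s : ℝ) (f g : MvPolynomial (Fin 3) ℝ) :
    poissonBracket s (toSphere s f) (toSphere s g) = toSphere s (polyBracket f g) := rfl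

/-- A Poisson subalgebra of `𝒫` is a real linear subspace closed under the Poisson bracket.
(Closure under the pointwise product is not required: `𝒫¹` is a Poisson subalgebra.) -/
def IsPoissonSubalgebra (s : ℝ) (A : Submodule ℝ (SpherePolynomial s)) : Prop :=
  ∀ p ∈ A, ∀ q ∈ A, poissonBracket s p q ∈ A

/-- The subspace `𝒫ᵏ` of elements of degree at most `k`, that is, of those classes which have a
polynomial representative of total degree at most `k`. -/
noncomputable def degreeLE (s : ℝ) (k : ℕ) : Submodule ℝ (SpherePolynomial s) :=
  (MvPolynomial.restrictTotalDegree (Fin 3) ℝ k).map (toSphere s).toLinearMap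

/-- The polynomials in `S₁, S₂, S₃` all of whose terms have odd degree. -/
def oddPoly : Submodule ℝ (MvPolynomial (Fin 3) ℝ) where
  carrier := {f | ∀ d ∈ f.support, Odd d.degree}
  zero_mem' := by simp
  add_mem' := by
    intro f g hf hg d hd
    rcases Finset.mem_union.1 (MvPolynomial.support_add hd) with h | h
    · exact hf d h
    · exact hg d h
  smul_mem' := by
    intro c f hf d hd
    exact hf d (MvPolynomial.support_smul hd)

/-- The subspace `𝒪` of `𝒫` consisting of the classes of odd polynomials. -/
noncomputable def oddPart (s : ℝ) : Submodule ℝ (SpherePolynomial s) :=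
  oddPoly.map (toSphere s).toLinearMap

/-- The subspace `Õ = 𝒪 ⊕ ℝ` of `𝒫`, where `ℝ` denotes the constants. -/
noncomputable def oddTilde (s : ℝ) : Submodule ℝ (SpherePolynomial s) :=
  oddPart s ⊔ Submodule.span ℝ {1}

end SpinSphere

/-!
Over `ℂ`, the elements `u = S₁ + i S₂`, `v = -(S₁ - i S₂)`, `w = i S₃` of `𝒫¹` form a ladder triple
with `u v = c - w²`, `c = -s²`, and bracketing with `w` splits a Poisson subalgebra `A ⊇ 𝒫¹` into
weight spaces, whose elements of weight `m ≥ 0` have the form `u ^ m q(w)`. An element of `A`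
outside `𝒫¹` has a component of this kind with `m + deg q ≥ 2` (up to exchanging `u` and `v`);
lowering it to weight `0` gives a polynomial `q(w)` of degree `d ≥ 2` in `A`. Raising and lowering
this polynomial `d` times shows that `u ^ d` and `v ^ d` are in `A`, and their bracket is a multiple
of `w (c - w²) ^ (d - 1)`, a polynomial in `w` of degree `2 d - 1 > d`. So there is no bound on the
exponents `n` with `w (c - w²) ^ n ∈ A`, and since lowering after raising (a Legendre-type operator)
leads from `n + 1` to `n` when `c ≠ 0`, all of them occur. These span the odd polynomials in `w`,
and raising and lowering give the remaining odd monomials.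
-/

namespace SpinSphere

theorem le_iSup_inf_of_le_eigenspace {K V ι : Type*} [Field K] [AddCommGroup V] [Module K V]
    {T : Module.End K V} {A : Submodule K V} (hT : A ≤ A.comap T) {μ : ι → K}
    (hμ : Function.Injective μ) {W : ι → Submodule K V} (hW : ∀ i, W i ≤ T.eigenspace (μ i))
    (hA : A ≤ ⨆ i, W i) : A ≤ ⨆ i, A ⊓ W i := by
  classical
  intro x hx
  obtain ⟨f, hf, rfl⟩ := (Submodule.mem_iSup_iff_exists_finsupp W x).1 (hA hx)
  refine Submodule.sum_mem _ fun i hi => Submodule.mem_iSup_of_mem i ⟨?_, hf i⟩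
  -- The Lagrange basis polynomials at the `μ i`, evaluated at `T`, project to the components.
  have aeval_apply (p : Polynomial K) (j : ι) :
      Polynomial.aeval T p (f j) = p.eval (μ j) • f j := by
    by_cases h0 : f j = 0
    · simp [h0]
    · exact Module.End.aeval_apply_of_hasEigenvector ⟨hW j (hf j), h0⟩
  have component :
      Polynomial.aeval T (Lagrange.basis f.support μ i) (f.sum fun _ y => y) = f i := by
    rw [Finsupp.sum, map_sum, Finset.sum_eq_single_of_mem i hi]
    · rw [aeval_apply, Lagrange.eval_basis_self hμ.injOn hi, one_smul]
    · intro j hj hji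
      rw [aeval_apply, Lagrange.eval_basis_of_ne hji.symm hj, zero_smul]
  rw [← component]
  exact Polynomial.aeval_apply_smul_mem_of_le_comap hx _ T hT

section Polynomial

open Polynomial

variable {K : Type*} [CommRing K]

/-- The action of the lowering element on coefficients: modulo `u v = c - w²`, the bracket of `v`
with `u ^ (m + 1) q(w)` is `u ^ m` times the value of this polynomial at `w`. -/
noncomputable def lowerPoly (c : K) (m : ℕ) (q : K[X]) : K[X] :=
  (C c - X ^ 2) * derivative q - C (2 * (m + 1) : K) * (X * q)

theorem natDegree_lowerPoly [IsDomain K] [CharZero K] (c : K) (m : ℕ) {q : K[X]} (hq : q ≠ 0) :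
    (lowerPoly c m q).natDegree = q.natDegree + 1 := by
  set E : K[X] := X * derivative q + C (2 * (m + 1) : K) * q with hE
  have coeff_E (n : ℕ) : E.coeff n = ((n + 2 * (m + 1) : ℕ) : K) * q.coeff n := by
    rw [hE, coeff_add, coeff_C_mul]
    cases n with
    | zero => simp
    | succ n => rw [coeff_X_mul, coeff_derivative]; push_cast; ring
  have coeff_E_natDegree : E.coeff q.natDegree ≠ 0 := by
    rw [coeff_E]
    exact mul_ne_zero (Nat.cast_ne_zero.2 (by omega)) (leadingCoeff_ne_zero.2 hq)
  have natDegree_E : E.natDegree = q.natDegree := by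
    refine natDegree_eq_of_le_of_coeff_ne_zero ?_ coeff_E_natDegree
    refine natDegree_le_iff_coeff_eq_zero.2 fun n hn => ?_
    rw [coeff_E, coeff_eq_zero_of_natDegree_lt hn, mul_zero]
  have E_ne_zero : E ≠ 0 := fun h => coeff_E_natDegree (by rw [h, coeff_zero])
  have natDegree_X_mul_E : (X * E).natDegree = q.natDegree + 1 := by
    rw [natDegree_X_mul E_ne_zero, natDegree_E]
  have lowerPoly_eq : lowerPoly c m q = C c * derivative q - X * E := by
    rw [lowerPoly, hE]; ring
  rw [lowerPoly_eq, natDegree_sub_eq_right_of_natDegree_lt, natDegree_X_mul_E]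
  have : (C c * derivative q).natDegree ≤ q.natDegree - 1 :=
    (natDegree_C_mul_le _ _).trans (natDegree_derivative_le q)
  omega

theorem derivative_C_sub_X_sq (c : K) : derivative (C c - X ^ 2) = -2 * X := by
  simp only [derivative_sub, derivative_C, derivative_X_sq, map_ofNat]
  ring

theorem lowerPoly_zero_derivative (c : K) (q : K[X]) :
    lowerPoly c 0 (derivative q) = derivative ((C c - X ^ 2) * derivative q) := by
  rw [lowerPoly, derivative_mul, derivative_C_sub_X_sq, Nat.cast_zero, zero_add, mul_one, map_ofNat]
  ring

theorem lowerPoly_zero_derivative_X_mul_pow_succ (c : K) (k : ℕ) :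
    lowerPoly c 0 (derivative (X * (C c - X ^ 2) ^ (k + 1))) =
      (4 * (k + 1) ^ 2 * c) • (X * (C c - X ^ 2) ^ k) -
        (2 * (2 * k + 3) * (k + 2) : K) • (X * (C c - X ^ 2) ^ (k + 1)) := by
  rw [lowerPoly_zero_derivative]
  set W : K[X] := C c - X ^ 2 with hW
  have derivative_W : derivative W = -2 * X := derivative_C_sub_X_sq c
  have X_sq : X ^ 2 = C c - W := by rw [hW]; ring
  have mul_derivative : W * derivative (X * W ^ (k + 1)) =
      C (2 * k + 3 : K) * W ^ (k + 1 + 1) - C (2 * (k + 1) * c) * W ^ (k + 1) := by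
    simp only [derivative_mul, derivative_X, derivative_pow_succ, derivative_W, map_add, map_mul,
      map_natCast, map_one, map_ofNat]
    linear_combination (-2 * (k + 1 : K[X]) * W ^ (k + 1)) * X_sq
  rw [mul_derivative]
  rw [derivative_sub, derivative_C_mul, derivative_C_mul, derivative_pow_succ, derivative_pow_succ,
    derivative_W]
  simp only [smul_eq_C_mul, map_add, map_mul, map_pow, map_natCast, map_one, map_ofNat,
    Nat.cast_add, Nat.cast_one]
  ring

end Polynomial

section Ladder

open Polynomial

variable {K R : Type*} [Field K] [CommRing R] [Algebra K R]

/-- Three elements `u`, `v`, `w` (raising, lowering, weight) which satisfy the commutation relations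
of `sl₂` for a skew-symmetric biderivation `br` of a commutative algebra. Skew-symmetry makes `br`
linear in its first argument, so this is all that is kept of a Poisson algebra. -/
structure IsLadderTriple (br : R → Derivation K R R) (u v w : R) : Prop where
  skew : ∀ x y, br x y = -br y x
  weight_raising : br w u = u
  weight_lowering : br w v = -v
  raising_lowering : br u v = 2 * w

/-- The ideal of the relation `u v = c - w²`, that is, of the quadric `u v + w² = c`. -/
def quadricIdeal (c : K) (u v w : R) : Ideal R :=
  Ideal.span {u * v - (algebraMap K R c - w ^ 2)}

/-- The elements which, modulo the relation `u v = c - w²`, are affine functions of `u`, `v`, `w`: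
the counterpart of `𝒫¹` in ladder coordinates. -/
def affinePart (c : K) (u v w : R) : Submodule K R :=
  Submodule.span K {1, u, v, w} ⊔ (quadricIdeal c u v w).restrictScalars K

/-- A subspace closed under the bracket which contains the affine functions, given as its
preimage in `R` (so it contains the ideal of the relation `u v = c - w²`). -/
structure IsLadderSubalgebra (br : R → Derivation K R R) (c : K) (u v w : R)
    (A : Submodule K R) : Prop extends IsLadderTriple br u v w where
  closed : ∀ x ∈ A, ∀ y ∈ A, br x y ∈ A
  affinePart_le : affinePart c u v w ≤ A

/-- The `w`-polynomials `q` for which the vector `u ^ m * q(w)` of weight `m` lies in `A`. -/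
noncomputable def weightPolys (A : Submodule K R) (u w : R) (m : ℕ) : Submodule K K[X] :=
  A.comap (LinearMap.mulLeft K (u ^ m) ∘ₗ (aeval w).toLinearMap)

theorem mem_weightPolys {A : Submodule K R} {u w : R} {m : ℕ} {q : K[X]} :
    q ∈ weightPolys A u w m ↔ u ^ m * aeval w q ∈ A :=
  Iff.rfl

theorem mem_weightPolys_zero {A : Submodule K R} {u w : R} {q : K[X]} :
    q ∈ weightPolys A u w 0 ↔ aeval w q ∈ A := by
  rw [mem_weightPolys, pow_zero, one_mul]

/-- The span of the monomials in `u`, `v`, `w` of weight `i`. -/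
def weightSpace (K : Type*) [Field K] [Algebra K R] (u v w : R) (i : ℤ) : Submodule K R :=
  Submodule.span K {x | ∃ a b k : ℕ, (a : ℤ) - b = i ∧ x = u ^ a * v ^ b * w ^ k}

theorem iSup_weightSpace_eq_top {u v w : R}
    (hgen : Function.Surjective (MvPolynomial.aeval (R := K) ![u, v, w])) :
    ⨆ i, weightSpace K u v w i = ⊤ := by
  refine Submodule.eq_top_iff'.2 fun x => ?_
  obtain ⟨F, rfl⟩ := hgen x
  rw [MvPolynomial.aeval_def, MvPolynomial.eval₂_eq']
  refine Submodule.sum_mem _ fun d _ => ?_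
  rw [← Algebra.smul_def, Fin.prod_univ_three]
  exact Submodule.smul_mem _ _ (Submodule.mem_iSup_of_mem _
    (Submodule.subset_span ⟨d 0, d 1, d 2, rfl, rfl⟩))

theorem pow_add_mul_pow_mul_pow_sub_mem_quadricIdeal (c : K) (u v w : R) (m b k : ℕ) :
    u ^ (m + b) * v ^ b * w ^ k - u ^ m * aeval w ((C c - X ^ 2) ^ b * X ^ k) ∈
      quadricIdeal c u v w := by
  have factor : u ^ (m + b) * v ^ b * w ^ k - u ^ m * aeval w ((C c - X ^ 2) ^ b * X ^ k) =
      ((u * v) ^ b - (algebraMap K R c - w ^ 2) ^ b) * (u ^ m * w ^ k) := by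
    simp only [map_mul, map_pow, map_sub, aeval_C, aeval_X]
    ring
  rw [factor]
  exact Ideal.mem_span_singleton.2 ((sub_dvd_pow_sub_pow _ _ b).mul_right _)

theorem exists_sub_mem_quadricIdeal_of_mem_weightSpace (c : K) {u v w : R} {n : ℕ} {x : R}
    (hx : x ∈ weightSpace K u v w n) :
    ∃ q : K[X], x - u ^ n * aeval w q ∈ quadricIdeal c u v w := by
  induction hx using Submodule.span_induction with
  | zero => exact ⟨0, by simp⟩
  | add x y _ _ hx hy =>
    obtain ⟨p, hp⟩ := hx
    obtain ⟨q, hq⟩ := hy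
    exact ⟨p + q, by simpa [mul_add, add_sub_add_comm] using Ideal.add_mem _ hp hq⟩
  | smul z x _ hx =>
    obtain ⟨q, hq⟩ := hx
    refine ⟨z • q, ?_⟩
    rw [map_smul, mul_smul_comm, ← smul_sub]
    exact Submodule.smul_of_tower_mem _ z hq
  | mem x hx =>
    obtain ⟨a, b, k, hab, rfl⟩ := hx
    obtain rfl : a = n + b := by omega
    exact ⟨_, pow_add_mul_pow_mul_pow_sub_mem_quadricIdeal c u v w n b k⟩

theorem quadricIdeal_swap (c : K) (u v w : R) :
    quadricIdeal c v u (-w) = quadricIdeal c u v w := by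
  rw [quadricIdeal, quadricIdeal, neg_sq, mul_comm]

theorem affinePart_swap (c : K) (u v w : R) : affinePart c v u (-w) = affinePart c u v w := by
  simp only [affinePart, quadricIdeal_swap, Submodule.span_insert, ← Set.neg_singleton w,
    Submodule.span_neg, sup_left_comm (Submodule.span K {v})]

theorem pow_mul_pow_mul_pow_eq_smul_swap (K : Type*) [Field K] [Algebra K R] (u v w : R)
    (a b k : ℕ) : u ^ a * v ^ b * w ^ k = (-1 : K) ^ k • (v ^ b * u ^ a * (-w) ^ k) := by
  have neg_one_pow_mul : (-1) ^ k * (-w) ^ k = w ^ k := by rw [← mul_pow, neg_one_mul, neg_neg]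
  rw [Algebra.smul_def, map_pow, map_neg, map_one]
  linear_combination (-(u ^ a * v ^ b)) * neg_one_pow_mul

theorem weightSpace_neg_le_swap (u v w : R) (i : ℤ) :
    weightSpace K u v w (-i) ≤ weightSpace K v u (-w) i := by
  refine Submodule.span_le.2 ?_
  rintro _ ⟨a, b, k, hab, rfl⟩
  rw [pow_mul_pow_mul_pow_eq_smul_swap K]
  exact Submodule.smul_mem _ _ (Submodule.subset_span ⟨b, a, k, by omega, rfl⟩)

namespace IsLadderTriple

variable {br : R → Derivation K R R} {u v w : R}

theorem br_self [CharZero K] (h : IsLadderTriple br u v w) (x : R) : br x x = 0 := by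
  have : (2 : K) • br x x = 0 := by
    rw [two_smul, ← eq_neg_iff_add_eq_zero]
    exact h.skew x x
  exact (smul_eq_zero_iff_right two_ne_zero).1 this

theorem raising_weight (h : IsLadderTriple br u v w) : br u w = -u := by
  rw [h.skew, h.weight_raising]

theorem lowering_weight (h : IsLadderTriple br u v w) : br v w = v := by
  rw [h.skew, h.weight_lowering, neg_neg]

theorem lowering_raising (h : IsLadderTriple br u v w) : br v u = -(2 * w) := by
  rw [h.skew, h.raising_lowering]

theorem swap (h : IsLadderTriple br u v w) : IsLadderTriple br v u (-w) where
  skew := h.skew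
  weight_raising := by rw [h.skew, map_neg, h.lowering_weight, neg_neg]
  weight_lowering := by rw [h.skew, map_neg, h.raising_weight, neg_neg]
  raising_lowering := by rw [h.lowering_raising, mul_neg]

theorem raising_pow_mul_aeval [CharZero K] (h : IsLadderTriple br u v w) (m : ℕ) (q : K[X]) :
    br u (u ^ m * aeval w q) = -(u ^ (m + 1) * aeval w (derivative q)) := by
  simp only [Derivation.leibniz, Derivation.leibniz_pow, h.br_self, Derivation.map_aeval,
    smul_eq_mul, h.raising_weight, mul_zero, nsmul_zero, add_zero]
  ring

theorem lowering_pow_succ_mul_aeval_sub (h : IsLadderTriple br u v w) (c : K) (m : ℕ)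
    (q : K[X]) :
    br v (u ^ (m + 1) * aeval w q) - u ^ m * aeval w (lowerPoly c m q) =
      (u * v - (algebraMap K R c - w ^ 2)) * (u ^ m * aeval w (derivative q)) := by
  simp only [lowerPoly, Derivation.leibniz, Derivation.leibniz_pow, Derivation.map_aeval,
    h.lowering_weight, h.lowering_raising, smul_eq_mul, nsmul_eq_mul, add_tsub_cancel_right,
    map_sub, map_mul, map_add, map_pow, aeval_X, aeval_C, map_natCast, map_one, map_ofNat,
    Nat.cast_add, Nat.cast_one]
  ring

theorem raising_pow_lowering_pow (h : IsLadderTriple br u v w) (n : ℕ) :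
    br (u ^ (n + 1)) (v ^ (n + 1)) = (2 * (n + 1) ^ 2 : K) • (u ^ n * v ^ n * w) := by
  rw [Derivation.leibniz_pow, h.skew, Derivation.leibniz_pow, h.lowering_raising]
  simp only [nsmul_eq_mul, Nat.cast_add, Nat.cast_one, add_tsub_cancel_right]
  simp only [smul_eq_mul, Algebra.smul_def, map_mul, map_pow, map_add, map_natCast, map_one,
    map_ofNat]
  ring

theorem weightSpace_le_eigenspace [CharZero K] (h : IsLadderTriple br u v w) (i : ℤ) :
    weightSpace K u v w i ≤ Module.End.eigenspace (br w).toLinearMap (i : K) := by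
  have mul_pow_pred (n : ℕ) (x : R) : (n : R) * (x ^ (n - 1) * x) = n * x ^ n := by
    cases n <;> simp [pow_succ]
  refine Submodule.span_le.2 ?_
  rintro _ ⟨a, b, k, rfl, rfl⟩
  refine Module.End.mem_eigenspace_iff.2 ?_
  simp only [Derivation.coeFn_coe, Derivation.leibniz, Derivation.leibniz_pow, h.br_self,
    h.weight_raising, h.weight_lowering, smul_eq_mul, Algebra.smul_def, mul_zero, zero_add,
    Int.cast_sub, Int.cast_natCast, map_sub, map_natCast]
  linear_combination (w ^ k * v ^ b) * mul_pow_pred a u - (w ^ k * u ^ a) * mul_pow_pred b v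

end IsLadderTriple

theorem comp_neg_X_mem_weightPolys_zero {A : Submodule K R} {u v w : R} {q : K[X]}
    (hq : q ∈ weightPolys A u w 0) : q.comp (-X) ∈ weightPolys A v (-w) 0 := by
  rw [mem_weightPolys_zero] at hq ⊢
  rwa [aeval_comp, map_neg, aeval_X, neg_neg]

namespace IsLadderSubalgebra

variable {br : R → Derivation K R R} {c : K} {u v w : R} {A : Submodule K R}

theorem swap (h : IsLadderSubalgebra br c u v w A) : IsLadderSubalgebra br c v u (-w) A where
  toIsLadderTriple := h.toIsLadderTriple.swap
  closed := h.closed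
  affinePart_le := (affinePart_swap c u v w).trans_le h.affinePart_le

theorem mem_of_sub_mem_quadricIdeal (h : IsLadderSubalgebra br c u v w A) {x y : R}
    (hx : x ∈ A) (hxy : x - y ∈ quadricIdeal c u v w) : y ∈ A := by
  rw [← sub_sub_cancel x y]
  exact A.sub_mem hx (h.affinePart_le (Submodule.mem_sup_right hxy))

theorem raising_mem (h : IsLadderSubalgebra br c u v w A) : u ∈ A :=
  h.affinePart_le (Submodule.mem_sup_left (Submodule.subset_span (by simp)))

theorem weight_mem (h : IsLadderSubalgebra br c u v w A) : w ∈ A :=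
  h.affinePart_le (Submodule.mem_sup_left (Submodule.subset_span (by simp)))

theorem lowerPoly_mem_weightPolys (h : IsLadderSubalgebra br c u v w A) {m : ℕ} {q : K[X]}
    (hq : q ∈ weightPolys A u w (m + 1)) : lowerPoly c m q ∈ weightPolys A u w m := by
  refine h.mem_of_sub_mem_quadricIdeal (h.closed v h.swap.raising_mem _ hq) ?_
  change br v (u ^ (m + 1) * aeval w q) - u ^ m * aeval w (lowerPoly c m q) ∈ _
  rw [h.lowering_pow_succ_mul_aeval_sub]
  exact Ideal.mul_mem_right _ _ (Ideal.mem_span_singleton_self _)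

section CharZero

variable [CharZero K]

theorem derivative_mem_weightPolys (h : IsLadderSubalgebra br c u v w A) {m : ℕ} {q : K[X]}
    (hq : q ∈ weightPolys A u w m) : derivative q ∈ weightPolys A u w (m + 1) := by
  rw [mem_weightPolys, ← neg_mem_iff, ← h.raising_pow_mul_aeval]
  exact h.closed u h.raising_mem _ hq

theorem exists_natDegree_eq_add (h : IsLadderSubalgebra br c u v w A) {m : ℕ} {q : K[X]}
    (hq0 : q ≠ 0) (hq : q ∈ weightPolys A u w m) :
    ∃ p ∈ weightPolys A u w 0, p.natDegree = m + q.natDegree := by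
  induction m generalizing q with
  | zero => exact ⟨q, hq, (zero_add _).symm⟩
  | succ m ih =>
    have natDegree_lower := natDegree_lowerPoly c m hq0
    obtain ⟨p, hp, hdeg⟩ :=
      ih (ne_zero_of_natDegree_gt (n := q.natDegree) (by omega)) (h.lowerPoly_mem_weightPolys hq)
    exact ⟨p, hp, by omega⟩

theorem one_mem_weightPolys_add_natDegree (h : IsLadderSubalgebra br c u v w A) {m : ℕ}
    {q : K[X]} (hq0 : q ≠ 0) (hq : q ∈ weightPolys A u w m) :
    1 ∈ weightPolys A u w (m + q.natDegree) := by
  induction hd : q.natDegree generalizing m q with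
  | zero =>
    rw [eq_C_of_natDegree_eq_zero hd, C_eq_algebraMap, Algebra.algebraMap_eq_smul_one] at hq
    refine (Submodule.smul_mem_iff _ fun h0 => hq0 ?_).1 hq
    rw [eq_C_of_natDegree_eq_zero hd, h0, C_0]
  | succ d ih =>
    have natDegree_deriv : (derivative q).natDegree = d := by
      rw [natDegree_derivative, hd, Nat.add_sub_cancel]
    have derivative_ne_zero : derivative q ≠ 0 := derivative_eq_zero.not.2 (by omega)
    have mem := ih derivative_ne_zero (h.derivative_mem_weightPolys hq) natDegree_deriv
    rwa [add_right_comm] at mem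

theorem raising_pow_natDegree_mem (h : IsLadderSubalgebra br c u v w A) {q : K[X]}
    (hq0 : q ≠ 0) (hq : q ∈ weightPolys A u w 0) : u ^ q.natDegree ∈ A := by
  simpa [mem_weightPolys] using h.one_mem_weightPolys_add_natDegree hq0 hq

theorem lowering_pow_natDegree_mem (h : IsLadderSubalgebra br c u v w A) {q : K[X]}
    (hq0 : q ≠ 0) (hq : q ∈ weightPolys A u w 0) : v ^ q.natDegree ∈ A := by
  have hq' : q.comp (-X) ∈ weightPolys A v (-w) 0 := comp_neg_X_mem_weightPolys_zero hq
  have natDegree_comp_neg : (q.comp (-X)).natDegree = q.natDegree := by simp [natDegree_comp]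
  simpa only [natDegree_comp_neg] using
    h.swap.raising_pow_natDegree_mem (comp_neg_X_eq_zero_iff.not.2 hq0) hq'

theorem X_mul_pow_mem_of_natDegree_eq_succ (h : IsLadderSubalgebra br c u v w A) {q : K[X]}
    (hq : q ∈ weightPolys A u w 0) {n : ℕ} (hn : q.natDegree = n + 1) :
    X * (C c - X ^ 2) ^ n ∈ weightPolys A u w 0 := by
  have hq0 : q ≠ 0 := ne_zero_of_natDegree_gt (n := n) (by omega)
  have bracket_mem := h.closed _ (hn ▸ h.raising_pow_natDegree_mem hq0 hq) _
    (hn ▸ h.lowering_pow_natDegree_mem hq0 hq)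
  have coeff_ne_zero : (2 * (n + 1) ^ 2 : K) ≠ 0 :=
    mul_ne_zero two_ne_zero (pow_ne_zero 2 (Nat.cast_add_one_ne_zero n))
  rw [h.raising_pow_lowering_pow, Submodule.smul_mem_iff _ coeff_ne_zero] at bracket_mem
  refine h.mem_of_sub_mem_quadricIdeal bracket_mem ?_
  rw [mul_comm X]
  simpa using pow_add_mul_pow_mul_pow_sub_mem_quadricIdeal c u v w 0 n 1

theorem X_mul_pow_mem_of_succ (h : IsLadderSubalgebra br c u v w A) (hc : c ≠ 0) {k : ℕ}
    (hk : X * (C c - X ^ 2) ^ (k + 1) ∈ weightPolys A u w 0) :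
    X * (C c - X ^ 2) ^ k ∈ weightPolys A u w 0 := by
  have lower_mem := h.lowerPoly_mem_weightPolys (h.derivative_mem_weightPolys hk)
  rw [lowerPoly_zero_derivative_X_mul_pow_succ] at lower_mem
  have coeff_ne_zero : (4 * (k + 1) ^ 2 * c : K) ≠ 0 := by
    simp [hc, Nat.cast_add_one_ne_zero (R := K) k]
  rwa [Submodule.sub_mem_iff_left _ (Submodule.smul_mem _ _ hk),
    Submodule.smul_mem_iff _ coeff_ne_zero] at lower_mem

theorem X_mul_pow_mem_of_le (h : IsLadderSubalgebra br c u v w A) (hc : c ≠ 0) {k n : ℕ}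
    (hkn : k ≤ n) (hn : X * (C c - X ^ 2) ^ n ∈ weightPolys A u w 0) :
    X * (C c - X ^ 2) ^ k ∈ weightPolys A u w 0 := by
  induction hkn with
  | refl => exact hn
  | step _ ih => exact ih (h.X_mul_pow_mem_of_succ hc hn)

theorem X_mul_pow_mem (h : IsLadderSubalgebra br c u v w A) (hc : c ≠ 0) {q : K[X]}
    (hq : q ∈ weightPolys A u w 0) (hdeg : 2 ≤ q.natDegree) (k : ℕ) :
    X * (C c - X ^ 2) ^ k ∈ weightPolys A u w 0 := by
  suffices hsucc : X * (C c - X ^ 2) ^ (k + 1) ∈ weightPolys A u w 0 from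
    h.X_mul_pow_mem_of_succ hc hsucc
  induction k with
  | zero =>
    exact h.X_mul_pow_mem_of_le hc (by omega)
      (h.X_mul_pow_mem_of_natDegree_eq_succ hq (Nat.sub_add_cancel (by omega)).symm)
  | succ k ih =>
    -- The degree `2 (k + 1) + 1` of the member at hand yields the exponent `2 (k + 1) ≥ k + 2`.
    have natDegree_eq : (X * (C c - X ^ 2) ^ (k + 1)).natDegree = 2 * (k + 1) + 1 := by
      have natDegree_W : (C c - X ^ 2).natDegree = 2 := by compute_degree!
      have W_ne_zero : C c - X ^ 2 ≠ 0 := ne_zero_of_natDegree_gt (n := 0) (by omega)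
      rw [natDegree_X_mul (pow_ne_zero _ W_ne_zero), natDegree_pow, natDegree_W, mul_comm]
    exact h.X_mul_pow_mem_of_le hc (by omega) (h.X_mul_pow_mem_of_natDegree_eq_succ ih natDegree_eq)

theorem X_pow_odd_mem (h : IsLadderSubalgebra br c u v w A) (hc : c ≠ 0) {q : K[X]}
    (hq : q ∈ weightPolys A u w 0) (hdeg : 2 ≤ q.natDegree) (k : ℕ) :
    X ^ (2 * k + 1) ∈ weightPolys A u w 0 := by
  suffices mul_pow_mem : ∀ j, X ^ (2 * k + 1) * (C c - X ^ 2) ^ j ∈ weightPolys A u w 0 by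
    simpa using mul_pow_mem 0
  induction k with
  | zero => simpa using h.X_mul_pow_mem hc hq hdeg
  | succ k ih =>
    intro j
    have X_sq_mul : X ^ (2 * (k + 1) + 1) * (C c - X ^ 2) ^ j =
        c • (X ^ (2 * k + 1) * (C c - X ^ 2) ^ j) - X ^ (2 * k + 1) * (C c - X ^ 2) ^ (j + 1) := by
      rw [smul_eq_C_mul]
      ring
    rw [X_sq_mul]
    exact Submodule.sub_mem _ (Submodule.smul_mem _ _ (ih j)) (ih (j + 1))

theorem X_pow_mem_of_odd_add (h : IsLadderSubalgebra br c u v w A) (hc : c ≠ 0) {q : K[X]}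
    (hq : q ∈ weightPolys A u w 0) (hdeg : 2 ≤ q.natDegree) {m k : ℕ} (hmk : Odd (m + k)) :
    X ^ k ∈ weightPolys A u w m := by
  induction m generalizing k with
  | zero =>
    obtain ⟨l, rfl⟩ : Odd k := by simpa using hmk
    exact h.X_pow_odd_mem hc hq hdeg l
  | succ m ih =>
    have deriv_mem := h.derivative_mem_weightPolys (ih (k := k + 1) (by convert hmk using 1; ring))
    rw [derivative_X_pow_succ, ← smul_eq_C_mul] at deriv_mem
    exact (Submodule.smul_mem_iff _ (Nat.cast_add_one_ne_zero k)).1 deriv_mem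

theorem C_sub_X_sq_pow_mul_X_pow_mem (h : IsLadderSubalgebra br c u v w A) (hc : c ≠ 0)
    {q : K[X]} (hq : q ∈ weightPolys A u w 0) (hdeg : 2 ≤ q.natDegree) {m k : ℕ}
    (hmk : Odd (m + k)) (b : ℕ) : (C c - X ^ 2) ^ b * X ^ k ∈ weightPolys A u w m := by
  induction b generalizing k with
  | zero => simpa using h.X_pow_mem_of_odd_add hc hq hdeg hmk
  | succ b ih =>
    have pow_succ_mul : (C c - X ^ 2) ^ (b + 1) * X ^ k =
        c • ((C c - X ^ 2) ^ b * X ^ k) - (C c - X ^ 2) ^ b * X ^ (k + 2) := by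
      rw [smul_eq_C_mul]
      ring
    rw [pow_succ_mul]
    exact Submodule.sub_mem _ (Submodule.smul_mem _ _ (ih hmk))
      (ih (by simpa [← add_assoc] using hmk.add_even even_two))

theorem pow_add_mul_pow_mul_pow_mem (h : IsLadderSubalgebra br c u v w A) (hc : c ≠ 0)
    {q : K[X]} (hq : q ∈ weightPolys A u w 0) (hdeg : 2 ≤ q.natDegree) {m k : ℕ}
    (hmk : Odd (m + k)) (b : ℕ) : u ^ (m + b) * v ^ b * w ^ k ∈ A := by
  refine h.mem_of_sub_mem_quadricIdeal (h.C_sub_X_sq_pow_mul_X_pow_mem hc hq hdeg hmk b) ?_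
  rw [← neg_mem_iff, neg_sub]
  exact pow_add_mul_pow_mul_pow_sub_mem_quadricIdeal c u v w m b k

theorem pow_mul_pow_mul_pow_mem (h : IsLadderSubalgebra br c u v w A) (hc : c ≠ 0)
    {q : K[X]} (hq : q ∈ weightPolys A u w 0) (hdeg : 2 ≤ q.natDegree) {a b k : ℕ}
    (hodd : Odd (a + b + k)) : u ^ a * v ^ b * w ^ k ∈ A := by
  rcases le_total b a with hab | hab
  · obtain ⟨m, rfl⟩ := Nat.exists_eq_add_of_le' hab
    exact h.pow_add_mul_pow_mul_pow_mem hc hq hdeg (by grind) b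
  · obtain ⟨m, rfl⟩ := Nat.exists_eq_add_of_le' hab
    rw [pow_mul_pow_mul_pow_eq_smul_swap K]
    refine Submodule.smul_mem _ _ (h.swap.pow_add_mul_pow_mul_pow_mem hc
      (comp_neg_X_mem_weightPolys_zero hq) ?_ (by grind) a)
    simpa [natDegree_comp] using hdeg

theorem inf_weightSpace_le_affinePart (h : IsLadderSubalgebra br c u v w A)
    (hdeg : ∀ q ∈ weightPolys A u w 0, q.natDegree < 2) (n : ℕ) :
    A ⊓ weightSpace K u v w n ≤ affinePart c u v w := by
  rintro x ⟨hxA, hx⟩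
  obtain ⟨q, hq⟩ := exists_sub_mem_quadricIdeal_of_mem_weightSpace c hx
  suffices u ^ n * aeval w q ∈ Submodule.span K {1, u, v, w} from
    Submodule.mem_sup.2 ⟨_, this, _, hq, add_sub_cancel _ _⟩
  by_cases hq0 : q = 0
  · simp [hq0]
  obtain ⟨p, hp, natDegree_p⟩ :=
    h.exists_natDegree_eq_add hq0 (h.mem_of_sub_mem_quadricIdeal hxA hq)
  have natDegree_lt := hdeg p hp
  obtain rfl | rfl : n = 0 ∨ n = 1 := by omega
  · obtain ⟨a, b, rfl⟩ := exists_eq_X_add_C_of_natDegree_le_one (show q.natDegree ≤ 1 by omega)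
    simp only [pow_zero, one_mul, map_add, map_mul, aeval_C, aeval_X,
      Algebra.algebraMap_eq_smul_one, smul_mul_assoc]
    exact add_mem (Submodule.smul_mem _ _ (Submodule.subset_span (by simp)))
      (Submodule.smul_mem _ _ (Submodule.subset_span (by simp)))
  · rw [eq_C_of_natDegree_eq_zero (show q.natDegree = 0 by omega), aeval_C, pow_one, mul_comm,
      ← Algebra.smul_def]
    exact Submodule.smul_mem _ _ (Submodule.subset_span (by simp))

theorem exists_two_le_natDegree (h : IsLadderSubalgebra br c u v w A)
    (hgen : Function.Surjective (MvPolynomial.aeval (R := K) ![u, v, w]))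
    (hA : ¬ A ≤ affinePart c u v w) : ∃ q ∈ weightPolys A u w 0, 2 ≤ q.natDegree := by
  by_contra! hdeg
  have hdeg_swap : ∀ q ∈ weightPolys A v (-w) 0, q.natDegree < 2 := fun q hq => by
    have mem := hdeg _ (neg_neg w ▸ comp_neg_X_mem_weightPolys_zero (v := u) hq)
    simpa [natDegree_comp] using mem
  have le_iSup : A ≤ ⨆ i : ℤ, A ⊓ weightSpace K u v w i :=
    le_iSup_inf_of_le_eigenspace (T := (br w).toLinearMap) (h.closed w h.weight_mem)
      Int.cast_injective h.weightSpace_le_eigenspace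
      (le_top.trans_eq (iSup_weightSpace_eq_top hgen).symm)
  refine hA (le_iSup.trans (iSup_le fun i => ?_))
  obtain ⟨n, rfl | rfl⟩ := i.eq_nat_or_neg
  · exact h.inf_weightSpace_le_affinePart hdeg n
  · rw [← affinePart_swap]
    exact (inf_le_inf_left A (weightSpace_neg_le_swap u v w n)).trans
      (h.swap.inf_weightSpace_le_affinePart hdeg_swap n)

theorem aeval_mem_of_isHomogeneous_odd (h : IsLadderSubalgebra br c u v w A) (hc : c ≠ 0)
    (hgen : Function.Surjective (MvPolynomial.aeval (R := K) ![u, v, w]))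
    (hA : ¬ A ≤ affinePart c u v w) {n : ℕ} (hn : Odd n) {G : MvPolynomial (Fin 3) K}
    (hG : G.IsHomogeneous n) : MvPolynomial.aeval ![u, v, w] G ∈ A := by
  obtain ⟨q, hq, hdeg⟩ := h.exists_two_le_natDegree hgen hA
  rw [MvPolynomial.aeval_def, MvPolynomial.eval₂_eq']
  refine Submodule.sum_mem _ fun d hd => ?_
  rw [← Algebra.smul_def, Fin.prod_univ_three]
  refine Submodule.smul_mem _ _ (h.pow_mul_pow_mul_pow_mem hc hq hdeg ?_)
  rwa [← Fin.sum_univ_three, ← Finsupp.degree_eq_sum, Finsupp.degree_apply,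
    ← hG.degree_eq_sum_deg_support hd]

end CharZero

end IsLadderSubalgebra

end Ladder

section ExtendScalars

open MvPolynomial

variable {σ K : Type*} (L : Type*) [Field K] [Field L] [Algebra K L]

/-- The extension of scalars from `K` to `L` of a subspace of `K[X]`, realised inside `L[X]`. -/
noncomputable def extendScalars (M : Submodule K (MvPolynomial σ K)) :
    Submodule L (MvPolynomial σ L) :=
  Submodule.span L (map (algebraMap K L) '' M)

variable {L} {M : Submodule K (MvPolynomial σ K)}

theorem map_mem_extendScalars {F : MvPolynomial σ K} (hF : F ∈ M) :
    map (algebraMap K L) F ∈ extendScalars L M :=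
  Submodule.subset_span ⟨F, hF, rfl⟩

theorem map_mem_extendScalars_iff {F : MvPolynomial σ K} :
    map (algebraMap K L) F ∈ extendScalars L M ↔ F ∈ M := by
  refine ⟨fun hF => ?_, map_mem_extendScalars⟩
  by_contra hFM
  obtain ⟨φ, hφF, hMφ⟩ := Submodule.exists_le_ker_of_notMem hFM
  let Φ : MvPolynomial σ L →ₗ[L] L :=
    (basisMonomials σ L).constr L fun d => algebraMap K L (φ (monomial d 1))
  have Φ_map (G : MvPolynomial σ K) : Φ (map (algebraMap K L) G) = algebraMap K L (φ G) := by
    induction G using MvPolynomial.induction_on' with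
    | monomial d a =>
      have Φ_monomial : Φ (monomial d 1) = algebraMap K L (φ (monomial d 1)) := by
        simpa using (basisMonomials σ L).constr_basis L
          (fun d => algebraMap K L (φ (monomial d 1))) d
      have monomial_eq_smul : monomial d a = a • monomial d (1 : K) := by
        rw [smul_monomial, smul_eq_mul, mul_one]
      rw [monomial_eq_smul, smul_eq_C_mul, map_mul, map_C, ← smul_eq_C_mul, map_monomial, map_one,
        map_smul, Φ_monomial, ← smul_eq_C_mul, map_smul, smul_eq_mul, smul_eq_mul, map_mul]
    | add p q hp hq => rw [map_add, map_add, map_add, map_add, hp, hq]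
  have extendScalars_le_ker : extendScalars L M ≤ LinearMap.ker Φ := by
    refine Submodule.span_le.2 ?_
    rintro _ ⟨G, hG, rfl⟩
    rw [SetLike.mem_coe, LinearMap.mem_ker, Φ_map, LinearMap.mem_ker.1 (hMφ hG), map_zero]
  have Φ_map_eq_zero := LinearMap.mem_ker.1 (extendScalars_le_ker hF)
  rw [Φ_map, map_eq_zero] at Φ_map_eq_zero
  exact hφF Φ_map_eq_zero

theorem span_singleton_map_le_extendScalars {r : MvPolynomial σ K}
    (hr : (Ideal.span {r}).restrictScalars K ≤ M) :
    (Ideal.span {map (algebraMap K L) r}).restrictScalars L ≤ extendScalars L M := by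
  intro x hx
  obtain ⟨F, rfl⟩ := Ideal.mem_span_singleton'.1 hx
  rw [F.as_sum, Finset.sum_mul]
  refine Submodule.sum_mem _ fun d _ => ?_
  have monomial_mul : monomial d (F.coeff d) * map (algebraMap K L) r =
      F.coeff d • map (algebraMap K L) (monomial d 1 * r) := by
    rw [map_mul, map_monomial, map_one, ← smul_mul_assoc, smul_monomial, smul_eq_mul, mul_one]
  rw [monomial_mul]
  exact Submodule.smul_mem _ _
    (map_mem_extendScalars (hr (Ideal.mul_mem_left _ _ (Ideal.mem_span_singleton_self r))))

end ExtendScalars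

section Complexification

open MvPolynomial

/-- The derivation `{F, ·}` of the polynomial algebra `R[S₁, S₂, S₃]`, for the bracket `polyBracket`
with coefficients in any commutative ring. -/
noncomputable def hamiltonianDerivation {R : Type*} [CommRing R] (F : MvPolynomial (Fin 3) R) :
    Derivation R (MvPolynomial (Fin 3) R) (MvPolynomial (Fin 3) R) :=
  (X 1 * pderiv 2 F - X 2 * pderiv 1 F) • pderiv 0 +
    (X 2 * pderiv 0 F - X 0 * pderiv 2 F) • pderiv 1 +
    (X 0 * pderiv 1 F - X 1 * pderiv 0 F) • pderiv 2

theorem hamiltonianDerivation_apply {R : Type*} [CommRing R] (F G : MvPolynomial (Fin 3) R) :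
    hamiltonianDerivation F G =
      (X 1 * pderiv 2 F - X 2 * pderiv 1 F) * pderiv 0 G +
        (X 2 * pderiv 0 F - X 0 * pderiv 2 F) * pderiv 1 G +
        (X 0 * pderiv 1 F - X 1 * pderiv 0 F) * pderiv 2 G :=
  rfl

theorem hamiltonianDerivation_skew {R : Type*} [CommRing R] (F G : MvPolynomial (Fin 3) R) :
    hamiltonianDerivation F G = -hamiltonianDerivation G F := by
  simp only [hamiltonianDerivation_apply]
  ring

theorem hamiltonianDerivation_map {R : Type*} [CommRing R] [Algebra ℝ R]
    (F G : MvPolynomial (Fin 3) ℝ) :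
    hamiltonianDerivation (map (algebraMap ℝ R) F) (map (algebraMap ℝ R) G) =
      map (algebraMap ℝ R) (polyBracket F G) := by
  simp only [hamiltonianDerivation_apply, polyBracket, pderiv_map, map_add, map_sub, map_mul, map_X]
  ring

theorem hamiltonianDerivation_mem_extendScalars {L : Type*} [Field L] [Algebra ℝ L]
    {M : Submodule ℝ (MvPolynomial (Fin 3) ℝ)} (hM : ∀ F ∈ M, ∀ G ∈ M, polyBracket F G ∈ M)
    {x y : MvPolynomial (Fin 3) L} (hx : x ∈ extendScalars L M) (hy : y ∈ extendScalars L M) :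
    hamiltonianDerivation x y ∈ extendScalars L M := by
  have left_mem {F : MvPolynomial (Fin 3) ℝ} (hF : F ∈ M) : extendScalars L M ≤
      (extendScalars L M).comap (hamiltonianDerivation (map (algebraMap ℝ L) F)).toLinearMap := by
    refine Submodule.span_le.2 ?_
    rintro _ ⟨G, hG, rfl⟩
    change hamiltonianDerivation (map _ F) (map _ G) ∈ extendScalars L M
    rw [hamiltonianDerivation_map]
    exact map_mem_extendScalars (hM F hF G hG)
  suffices extendScalars L M ≤
      (extendScalars L M).comap (hamiltonianDerivation x).toLinearMap from this hy
  refine Submodule.span_le.2 ?_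
  rintro _ ⟨G, hG, rfl⟩
  change hamiltonianDerivation x (map (algebraMap ℝ L) G) ∈ extendScalars L M
  rw [hamiltonianDerivation_skew, neg_mem_iff]
  exact left_mem hG hx

/-- The raising element `S₁ + i S₂`. -/
noncomputable def spinRaising : MvPolynomial (Fin 3) ℂ := X 0 + C Complex.I * X 1

/-- The lowering element `-(S₁ - i S₂)`. The sign makes the bracket satisfy `IsLadderTriple`
without a factor `i`. -/
noncomputable def spinLowering : MvPolynomial (Fin 3) ℂ := -X 0 + C Complex.I * X 1

/-- The weight element `i S₃`. -/
noncomputable def spinWeight : MvPolynomial (Fin 3) ℂ := C Complex.I * X 2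

theorem C_I_sq : (C Complex.I : MvPolynomial (Fin 3) ℂ) ^ 2 = -1 := by
  rw [← C_pow, Complex.I_sq, C_neg, C_1]

theorem pderiv_spinRaising (i : Fin 3) : pderiv i spinRaising = ![1, C Complex.I, 0] i := by
  fin_cases i <;> simp [spinRaising, pderiv_X]

theorem pderiv_spinLowering (i : Fin 3) : pderiv i spinLowering = ![-1, C Complex.I, 0] i := by
  fin_cases i <;> simp [spinLowering, pderiv_X]

theorem pderiv_spinWeight (i : Fin 3) : pderiv i spinWeight = ![0, 0, C Complex.I] i := by
  fin_cases i <;> simp [spinWeight, pderiv_X]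

theorem isLadderTriple_spin :
    IsLadderTriple hamiltonianDerivation spinRaising spinLowering spinWeight where
  skew := hamiltonianDerivation_skew
  weight_raising := by
    simp only [hamiltonianDerivation_apply, pderiv_spinRaising, pderiv_spinWeight, Matrix.cons_val]
    rw [spinRaising]
    linear_combination (-X 0) * C_I_sq
  weight_lowering := by
    simp only [hamiltonianDerivation_apply, pderiv_spinLowering, pderiv_spinWeight, Matrix.cons_val]
    rw [spinLowering]
    linear_combination (-X 0) * C_I_sq
  raising_lowering := by
    simp only [hamiltonianDerivation_apply, pderiv_spinRaising, pderiv_spinLowering,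
      Matrix.cons_val]
    rw [spinWeight]
    ring

theorem quadricIdeal_spin (s : ℝ) :
    quadricIdeal (-(s : ℂ) ^ 2) spinRaising spinLowering spinWeight =
      Ideal.span {map (algebraMap ℝ ℂ) (spherePoly s)} := by
  rw [quadricIdeal, ← Ideal.span_singleton_neg]
  congr 2
  simp only [spinRaising, spinLowering, spinWeight, spherePoly, algebraMap_eq, map_neg, map_add,
    map_sub, map_pow, map_X, map_C, Complex.coe_algebraMap]
  linear_combination (-(X 1 ^ 2 + X 2 ^ 2)) * C_I_sq

/-- The expressions of `S₁`, `S₂`, `S₃` as linear forms in the ladder elements. -/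
noncomputable def ladderCoordinates : Fin 3 → MvPolynomial (Fin 3) ℂ :=
  ![C 2⁻¹ * (X 0 - X 1), C 2⁻¹ * (C (-Complex.I) * (X 0 + X 1)), C (-Complex.I) * X 2]

theorem aeval_spin_ladderCoordinates (F : MvPolynomial (Fin 3) ℂ) :
    aeval ![spinRaising, spinLowering, spinWeight] (aeval ladderCoordinates F) = F := by
  have two_mul_half : (2 * C 2⁻¹ : MvPolynomial (Fin 3) ℂ) = 1 := by
    rw [← map_ofNat C, ← C_mul, mul_inv_cancel₀ two_ne_zero, C_1]
  have aeval_coordinate (i : Fin 3) :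
      aeval ![spinRaising, spinLowering, spinWeight] (ladderCoordinates i) = X i := by
    fin_cases i <;>
      simp only [ladderCoordinates, Fin.zero_eta, Fin.mk_one, Fin.reduceFinMk, Matrix.cons_val,
        map_mul, map_sub, map_add, aeval_X, aeval_C, algebraMap_eq, map_neg, spinRaising,
        spinLowering, spinWeight]
    · linear_combination X 0 * two_mul_half
    · linear_combination X 1 * two_mul_half - 2 * C 2⁻¹ * X 1 * C_I_sq
    · linear_combination (-X 2) * C_I_sq
  rw [comp_aeval_apply]
  simp only [aeval_coordinate]
  exact aeval_X_left_apply F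

theorem isHomogeneous_aeval_ladderCoordinates {n : ℕ} {F : MvPolynomial (Fin 3) ℂ}
    (hF : F.IsHomogeneous n) : (aeval ladderCoordinates F).IsHomogeneous n := by
  have isHomogeneous_coordinate (i : Fin 3) : (ladderCoordinates i).IsHomogeneous 1 := by
    fin_cases i
    · exact ((isHomogeneous_X _ _).sub (isHomogeneous_X _ _)).C_mul _
    · exact (((isHomogeneous_X _ _).add (isHomogeneous_X _ _)).C_mul _).C_mul _
    · exact (isHomogeneous_X _ _).C_mul _
  simpa only [one_mul] using hF.aeval ladderCoordinates isHomogeneous_coordinate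

/-- The complexification of a subspace of `𝒫`, given as its preimage in `ℂ[S₁, S₂, S₃]`. -/
noncomputable def complexification (s : ℝ) (A : Submodule ℝ (SpherePolynomial s)) :
    Submodule ℂ (MvPolynomial (Fin 3) ℂ) :=
  extendScalars ℂ (A.comap (toSphere s).toLinearMap)

variable {s : ℝ} {A : Submodule ℝ (SpherePolynomial s)}

theorem map_mem_complexification_iff {F : MvPolynomial (Fin 3) ℝ} :
    map (algebraMap ℝ ℂ) F ∈ complexification s A ↔ toSphere s F ∈ A :=
  map_mem_extendScalars_iff

theorem toSphere_mem_degreeLE {k : ℕ} {F : MvPolynomial (Fin 3) ℝ} (hF : F.totalDegree ≤ k) :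
    toSphere s F ∈ degreeLE s k :=
  ⟨F, (mem_restrictTotalDegree _ _ _).2 hF, rfl⟩

theorem affinePart_le_complexification (hA : degreeLE s 1 ≤ A) :
    affinePart (-(s : ℂ) ^ 2) spinRaising spinLowering spinWeight ≤ complexification s A := by
  have map_mem {F : MvPolynomial (Fin 3) ℝ} (hF : F.totalDegree ≤ 1) :
      map (algebraMap ℝ ℂ) F ∈ complexification s A :=
    map_mem_complexification_iff.2 (hA (toSphere_mem_degreeLE hF))
  have one_mem : 1 ∈ complexification s A := by simpa using map_mem (F := 1) (by simp)
  have X_mem (i : Fin 3) : X i ∈ complexification s A := by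
    simpa using map_mem (F := X i) (totalDegree_X i).le
  have C_mul_X_mem (z : ℂ) (i : Fin 3) : C z * X i ∈ complexification s A := by
    rw [C_mul']
    exact Submodule.smul_mem _ z (X_mem i)
  refine sup_le (Submodule.span_le.2 ?_) ?_
  · rintro _ (rfl | rfl | rfl | rfl)
    · exact one_mem
    · exact add_mem (X_mem 0) (C_mul_X_mem _ 1)
    · exact add_mem (neg_mem (X_mem 0)) (C_mul_X_mem _ 1)
    · exact C_mul_X_mem _ 2
  · rw [quadricIdeal_spin]
    refine span_singleton_map_le_extendScalars fun F hF => ?_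
    have toSphere_eq_zero : toSphere s F = 0 := Ideal.Quotient.eq_zero_iff_mem.2 hF
    exact Submodule.mem_comap.2 (toSphere_eq_zero ▸ A.zero_mem)

theorem not_complexification_le_affinePart (hA : degreeLE s 1 < A) :
    ¬ complexification s A ≤ affinePart (-(s : ℂ) ^ 2) spinRaising spinLowering spinWeight := by
  intro hle
  obtain ⟨p, hpA, hp⟩ := SetLike.exists_of_lt hA
  obtain ⟨F, rfl⟩ := Ideal.Quotient.mkₐ_surjective ℝ (sphereIdeal s) p
  exact hp (map_mem_complexification_iff.1
    (affinePart_le_complexification le_rfl (hle (map_mem_complexification_iff.2 hpA))))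

theorem isLadderSubalgebra_complexification (hA : IsPoissonSubalgebra s A)
    (hdeg : degreeLE s 1 ≤ A) :
    IsLadderSubalgebra hamiltonianDerivation (-(s : ℂ) ^ 2) spinRaising spinLowering spinWeight
      (complexification s A) where
  toIsLadderTriple := isLadderTriple_spin
  closed _ hx _ hy := hamiltonianDerivation_mem_extendScalars
    (fun _ hF _ hG => hA _ hF _ hG) hx hy
  affinePart_le := affinePart_le_complexification hdeg

theorem toSphere_mem_of_isHomogeneous_odd (hs : s ≠ 0) (hA : IsPoissonSubalgebra s A)
    (hlt : degreeLE s 1 < A) {n : ℕ} (hn : Odd n) {F : MvPolynomial (Fin 3) ℝ}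
    (hF : F.IsHomogeneous n) : toSphere s F ∈ A := by
  have c_ne_zero : -(s : ℂ) ^ 2 ≠ 0 := by simpa using hs
  have surjective : Function.Surjective
      (aeval (R := ℂ) ![spinRaising, spinLowering, spinWeight]) :=
    fun G => ⟨_, aeval_spin_ladderCoordinates G⟩
  rw [← map_mem_complexification_iff, ← aeval_spin_ladderCoordinates (map _ F)]
  exact (isLadderSubalgebra_complexification hA hlt.le).aeval_mem_of_isHomogeneous_odd c_ne_zero
    surjective (not_complexification_le_affinePart hlt) hn
    (isHomogeneous_aeval_ladderCoordinates (hF.map _))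

end Complexification

end SpinSphere

theorem mainTheorem7 (s : ℝ) (hs : 0 < s)
    (A : Submodule ℝ (SpinSphere.SpherePolynomial s))
    (hA : SpinSphere.IsPoissonSubalgebra s A)
    (hlt : SpinSphere.degreeLE s 1 < A) :
    SpinSphere.oddTilde s ≤ A := by
  refine sup_le (Submodule.map_le_iff_le_comap.2 fun F hF => ?_) ?_
  · rw [F.as_sum]
    exact Submodule.sum_mem _ fun d hd => SpinSphere.toSphere_mem_of_isHomogeneous_odd hs.ne' hA hlt
      (hF d hd) (MvPolynomial.isHomogeneous_monomial _ rfl)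
  · rw [Submodule.span_singleton_le_iff_mem, ← map_one (SpinSphere.toSphere s)]
    exact hlt.le (SpinSphere.toSphere_mem_degreeLE (by simp))
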